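/- Theorem 3.5 (\label{TraceIdealAffine}). Let $k$ be a field, let $S\subseteq\mathbb{Z}^d$ be an affine semigroup (a finitely generated additive submonoid), and let $R=k[S]=\bigoplus_{\mathbf a\in S}k\,\mathbf{x}^{\mathbf a}$ be its semigroup ring, with an $\mathbb{N}$-grading in which $\mathbf{x}^{\mathbf a}$ has degree $\deg(\mathbf a)$ for an additive monoid homomorphism $\deg:S\to\mathbb{N}$. Suppose that $R$ is semi-standard graded, i.e. $R$ is noetherian, $R_0=k$, and $R$ is finitely generated as a module over the subalgebra $k[R_1]$. Let $\mathbf m=\bigoplus_{i>0}R_i$, and suppose that $\operatorname{depth}R\ge 2$, i.e. $\mathbf m$ contains an $R$-regular sequence of length at least $2$. (Cohen–Macaulayness is not assumed.) Let $G_S$ be the unique minimal generating set of $S$. A face of $S$ is a subset $F\subseteq S$ such that for all $\mathbf a,\mathbf b\in S$ one has $\mathbf a+\mathbf b\in F$ if and only if $\mathbf a\in F$ and $\mathbf b\in F$; its dimension is the rank of the group $\mathbb{Z}F$. Let $E_S$ be the set of all $\mathbf a\in G_S$ such that $\mathbb{N}\mathbf a$ is a $1$-dimensional face of $S$. For a graded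 ideal $I$ of $R$, put $I_i=I\cap R_i$ and $$\operatorname{tr}(I)=\sum_{\varphi}\varphi(I),$$ where $\varphi$ runs over the $R$-linear maps $I\to R$ that are homogeneous of some degree $n\in\mathbb{Z}$ (that is, $\varphi(I_i)\subseteq R_{i+n}$ for all $i$, with $R_j=0$ for $j<0$). Let $I$ be a graded ideal of $R$ that is not principal, and let $b=\min\{i: I_i\ne 0\}$. If $$(\mathbf{x}^{\mathbf e} : \mathbf e\in E_S)R\subseteq \operatorname{tr}(I),$$ then $\dim_k I_b\ge 2$. -/

import Mathlib

noncomputable section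

namespace SemiStandard

/-- An `ℕ`-graded algebra `R = ⨁ R_i` over a field `k` is semi-standard graded if it is noetherian,
`R_0 = k`, and `R` is a finitely generated module over its subalgebra `k[R_1]`. -/
structure IsSemiStandardGraded {k R : Type*} [Field k] [CommRing R] [Algebra k R]
    (𝒜 : ℕ → Submodule k R) [GradedAlgebra 𝒜] : Prop where
  noetherian : IsNoetherianRing R
  algebraMap_injective : Function.Injective (algebraMap k R)
  degree_zero : 𝒜 0 = (1 : Submodule k R)
  finite : Module.Finite (Algebra.adjoin k (𝒜 1 : Set R)) R

/-- The depth of a ring `R` with respect to an ideal `m`: the supremum of the lengths of the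
`R`-regular sequences contained in `m`. -/
def depth {R : Type*} [CommRing R] (m : Ideal R) : ℕ∞ :=
  ⨆ (rs : List R) (_ : RingTheory.Sequence.IsRegular R rs ∧ ∀ r ∈ rs, r ∈ m), (rs.length : ℕ∞)

/-- The depth of an `ℕ`-graded algebra with `R_0 = k` a field: the depth with respect to the
unique graded maximal ideal `⨁_{i > 0} R_i`. -/
def gradedDepth {k R : Type*} [Field k] [CommRing R] [Algebra k R]
    (𝒜 : ℕ → Submodule k R) [GradedAlgebra 𝒜] : ℕ∞ :=
  depth (HomogeneousIdeal.irrelevant 𝒜).toIdeal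

/-- The graded piece `R_n` for an integer `n`, which is zero when `n < 0`. -/
def intPiece {k R : Type*} [Field k] [CommRing R] [Algebra k R]
    (𝒜 : ℕ → Submodule k R) : ℤ → Submodule k R
  | Int.ofNat n => 𝒜 n
  | Int.negSucc _ => ⊥

/-- An `R`-linear map `φ : I → R` on a graded ideal is a graded homomorphism if it is homogeneous
of some degree `n ∈ ℤ`, i.e. `φ(I_i) ⊆ R_{i+n}` for all `i`. -/
def IsGradedHom {k R : Type*} [Field k] [CommRing R] [Algebra k R]
    (𝒜 : ℕ → Submodule k R) (I : Ideal R) (φ : I →ₗ[R] R) : Prop :=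
  ∃ n : ℤ, ∀ (i : ℕ) (a : I), (a : R) ∈ 𝒜 i → φ a ∈ intPiece 𝒜 ((i : ℤ) + n)

/-- The trace ideal `tr(I)`: the sum of the images `φ(I)` over all graded homomorphisms
`φ : I → R`. -/
def traceIdeal {k R : Type*} [Field k] [CommRing R] [Algebra k R]
    (𝒜 : ℕ → Submodule k R) (I : Ideal R) : Ideal R :=
  ⨆ (φ : I →ₗ[R] R) (_ : IsGradedHom 𝒜 I φ), LinearMap.range φ

/-- The graded piece `I_i = I ∩ R_i` of a graded ideal. -/
def idealPiece {k R : Type*} [Field k] [CommRing R] [Algebra k R]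
    (𝒜 : ℕ → Submodule k R) (I : Ideal R) (i : ℕ) : Submodule k R :=
  I.restrictScalars k ⊓ 𝒜 i

/-- The elements that lie in every generating set of `S`. For a pointed affine semigroup this is
its unique minimal generating set `G_S`. -/
def minimalGenerators {d : ℕ} (S : AddSubmonoid (Fin d → ℤ)) : Set S :=
  {a | ∀ G : Set S, AddSubmonoid.closure G = ⊤ → a ∈ G}

/-- A face of `S` is a subset `F` such that `a + b ∈ F ↔ a ∈ F ∧ b ∈ F` for all `a, b ∈ S`. -/
def IsFace {d : ℕ} (S : AddSubmonoid (Fin d → ℤ)) (F : Set S) : Prop :=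
  ∀ a b : S, a + b ∈ F ↔ a ∈ F ∧ b ∈ F

/-- The dimension of a face `F`: the rank of the group `ℤF` that it generates. -/
def faceDim {d : ℕ} (S : AddSubmonoid (Fin d → ℤ)) (F : Set S) : ℕ :=
  Module.finrank ℤ (Submodule.span ℤ ((fun a : S => (a : Fin d → ℤ)) '' F))

/-- `E_S`: the minimal generators `a` of `S` for which `ℕa` is a one-dimensional face of `S`. -/
def extremalGenerators {d : ℕ} (S : AddSubmonoid (Fin d → ℤ)) : Set S :=
  {a | a ∈ minimalGenerators S ∧
    IsFace S (AddSubmonoid.multiples a : Set S) ∧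
    faceDim S (AddSubmonoid.multiples a : Set S) = 1}

/-- The ideal `(x^e : e ∈ E_S)` of the semigroup ring `k[S]`. -/
def extremalIdeal (k : Type*) [Field k] {d : ℕ} (S : AddSubmonoid (Fin d → ℤ)) :
    Ideal (AddMonoidAlgebra k S) :=
  Ideal.span ((fun e : S => AddMonoidAlgebra.single e (1 : k)) '' extremalGenerators S)

end SemiStandard

end

/-!
Suppose that `dim I_b = 1`, say `I_b = k f`. The ring `R = k[S]` is a domain, so every graded
homomorphism `I → R` is multiplication by a fraction. One of degree `n` takes into `R_1` only
elements of `I_{1-n}`. If `1 - n < b` there are none; if `1 - n > b`, it sends `f` to a constant,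
which is zero because `I ≠ (f)`; and if `1 - n = b`, it sends `f` to an element `x` of `R_1` with
`x I ⊆ f R`. Hence the degree-one part of `tr(I)` lies in the colon ideal `(f) : I`
(`proj_one_mul_mem_span_of_mem_traceIdeal`).

The extremal generators of degree one already generate the maximal ideal `m` up to radical
(`irrelevant_le_radical`). Indeed, below a nonzero `a ∈ S` there is a minimal nonzero face. On it
the ratio of any coordinate to the degree is constant, as otherwise the locus where it is maximal
would be a smaller nonzero face (`exists_face_coord_mul_degree_eq`). The face contains an element
of degree one because `R` is integral over `k[R_1]` (`exists_nsmul_mem_closure_degree_one`), so it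
is the ray `ℕe` spanned by that element.

So every element of `m` has a power multiplying `I` into `(f)`. Applied to a regular sequence of
length two in `m`, this forces `I ⊆ (f)` (`dvd_of_dvd_pow_mul`), and `I` would be principal
(`two_le_finrank_idealPiece`).
-/

namespace SemiStandard

/-! ### Graded homomorphisms and the trace ideal -/

section Graded

variable {k R : Type*} [Field k] [CommRing R] [Algebra k R]
  (𝒜 : ℕ → Submodule k R) [GradedAlgebra 𝒜]

/-- A homomorphism of degree `n` commutes with taking homogeneous components: the component of
degree `m` of `φ a` is `φ` of the component of degree `m - n` of `a`, or zero if `m < n`. -/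
theorem proj_apply_eq_or_eq_zero {I : Ideal R} (hI : I.IsHomogeneous 𝒜) {φ : I →ₗ[R] R} {n : ℤ}
    (hφ : ∀ (i : ℕ) (a : I), (a : R) ∈ 𝒜 i → φ a ∈ intPiece 𝒜 ((i : ℤ) + n)) (m : ℕ) (a : I) :
    (∃ (i : ℕ) (a' : I), (i : ℤ) + n = m ∧ (a' : R) ∈ 𝒜 i ∧
      (DirectSum.decompose 𝒜 (φ a) m : R) = φ a') ∨
      (DirectSum.decompose 𝒜 (φ a) m : R) = 0 := by
  classical
  let c : ℕ → I := fun i => ⟨DirectSum.decompose 𝒜 (a : R) i, hI i a.2⟩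
  have hc : ∀ i, (c i : R) ∈ 𝒜 i := fun i => SetLike.coe_mem _
  have hsum : a = ∑ i ∈ (DirectSum.decompose 𝒜 (a : R)).support, c i := by
    apply Subtype.ext
    rw [AddSubmonoidClass.coe_finsetSum]
    exact (DirectSum.sum_support_decompose 𝒜 (a : R)).symm
  have hproj : ∀ i, (DirectSum.decompose 𝒜 (φ (c i)) m : R) =
      if (i : ℤ) + n = m then φ (c i) else 0 := by
    intro i
    have h := hφ i (c i) (hc i)
    split_ifs with him
    · rw [him] at h
      exact DirectSum.decompose_of_mem_same 𝒜 h
    · rcases hj : (i : ℤ) + n with j | j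
      · rw [hj] at h
        refine DirectSum.decompose_of_mem_ne 𝒜 h ?_
        rintro rfl
        exact him hj
      · rw [hj] at h
        rw [(Submodule.mem_bot k).1 h]
        simp
  have hcomp : (DirectSum.decompose 𝒜 (φ a) m : R) =
      ∑ i ∈ (DirectSum.decompose 𝒜 (a : R)).support,
        if (i : ℤ) + n = m then φ (c i) else 0 := by
    conv_lhs => rw [hsum]
    rw [map_sum, DirectSum.decompose_sum, DFinsupp.finsetSum_apply,
      AddSubmonoidClass.coe_finsetSum]
    exact Finset.sum_congr rfl fun i _ => hproj i
  by_cases hex : ∃ i ∈ (DirectSum.decompose 𝒜 (a : R)).support, (i : ℤ) + n = m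
  · obtain ⟨i, hi, him⟩ := hex
    refine Or.inl ⟨i, c i, him, hc i, ?_⟩
    rw [hcomp, Finset.sum_eq_single i]
    · rw [if_pos him]
    · intro j _ hji
      rw [if_neg]
      intro hj
      exact hji (by omega)
    · exact fun h => absurd hi h
  · right
    rw [hcomp]
    refine Finset.sum_eq_zero fun i hi => if_neg fun h => hex ⟨i, hi, h⟩

/-- The heart of the argument: if the initial piece `I_b` is spanned by `f`, then the component of
degree one of every element of `tr(I)` multiplies `I` into `(f)`, unless `I = (f)`. -/
theorem proj_one_mul_mem_span_of_mem_traceIdeal [IsDomain R] (h0 : 𝒜 0 = (1 : Submodule k R))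
    {I : Ideal R} (hI : I.IsHomogeneous 𝒜) {b : ℕ} {f : R} (hf : f ∈ 𝒜 b) (hfI : f ∈ I)
    (hf0 : f ≠ 0) (hlt : ∀ i < b, idealPiece 𝒜 I i = ⊥)
    (hspan : ∀ g ∈ idealPiece 𝒜 I b, ∃ c : k, c • f = g) (hne : ¬ I ≤ Ideal.span {f})
    {x : R} (hx : x ∈ traceIdeal 𝒜 I) {h : R} (hh : h ∈ I) :
    (DirectSum.decompose 𝒜 x 1 : R) * h ∈ Ideal.span {f} := by
  -- `φ` is multiplication by a fraction, expressed without denominators.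
  have hswap : ∀ (φ : I →ₗ[R] R) (u v : I), φ u * v = φ v * u := by
    intro φ u v
    have h1 := φ.map_smul (v : R) u
    have h2 := φ.map_smul (u : R) v
    have h3 : (v : R) • u = (u : R) • v := Subtype.ext (mul_comm _ _)
    rw [h3, h2] at h1
    simp only [smul_eq_mul] at h1
    rw [mul_comm, ← h1, mul_comm]
  have hsup : traceIdeal 𝒜 I = ⨆ φ : {φ : I →ₗ[R] R // IsGradedHom 𝒜 I φ},
      LinearMap.range φ.1 := by
    rw [traceIdeal, iSup_subtype']
  rw [hsup] at hx
  induction hx using Submodule.iSup_induction' with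
  | zero => simp
  | add y z _ _ hy hz =>
    rw [DirectSum.decompose_add, DirectSum.add_apply, Submodule.coe_add, add_mul]
    exact Ideal.add_mem _ hy hz
  | mem φ y hy =>
    obtain ⟨φ, n, hn⟩ := φ
    obtain ⟨a, rfl⟩ := hy
    dsimp only
    obtain ⟨i, a', hi, ha', heq⟩ | heq := proj_apply_eq_or_eq_zero 𝒜 hI hn 1 a
    swap
    · rw [heq, zero_mul]
      exact Ideal.zero_mem _
    rw [heq]
    rcases lt_trichotomy i b with hib | rfl | hib
    · have : (a' : R) ∈ idealPiece 𝒜 I i := ⟨a'.2, ha'⟩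
      rw [hlt i hib, Submodule.mem_bot] at this
      have ha0 : a' = 0 := Subtype.ext this
      rw [ha0, map_zero, zero_mul]
      exact Ideal.zero_mem _
    · obtain ⟨c, hc⟩ := hspan a' ⟨a'.2, ha'⟩
      rw [hswap φ a' ⟨h, hh⟩, ← hc]
      exact Ideal.mul_mem_left _ _
        (Submodule.smul_of_tower_mem _ c (Ideal.mem_span_singleton_self f))
    · -- Here `φ` has degree at most `-b`, so `φ f` is a constant; a nonzero constant would give
      -- `I = (f)`, and `φ f = 0` forces `φ = 0`.
      have hφf := hn b ⟨f, hfI⟩ hf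
      have hφf0 : φ ⟨f, hfI⟩ ∈ 𝒜 0 := by
        rcases hj : (b : ℤ) + n with j | j
        · rw [hj] at hφf
          have : j = 0 := by
            rw [Int.ofNat_eq_natCast] at hj
            omega
          rwa [this] at hφf
        · rw [hj] at hφf
          rw [(Submodule.mem_bot k).1 hφf]
          exact Submodule.zero_mem _
      rw [h0, Submodule.mem_one] at hφf0
      obtain ⟨c, hc⟩ := hφf0
      by_cases hc0 : c = 0
      · rw [hc0, map_zero] at hc
        have := hswap φ a' ⟨f, hfI⟩
        rw [← hc, zero_mul] at this
        rw [(mul_eq_zero.1 this).resolve_right hf0, zero_mul]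
        exact Ideal.zero_mem _
      · exfalso
        apply hne
        intro u hu
        have := hswap φ ⟨f, hfI⟩ ⟨u, hu⟩
        rw [← hc] at this
        dsimp only at this
        have hu' : u = algebraMap k R c⁻¹ * φ ⟨u, hu⟩ * f := by
          rw [mul_assoc, ← this, ← mul_assoc, ← map_mul, inv_mul_cancel₀ hc0, map_one, one_mul]
        rw [hu']
        exact Ideal.mul_mem_left _ _ (Ideal.mem_span_singleton_self f)

end Graded

/-! ### Regular sequences of length two -/

/-- In a domain, a regular sequence `r, s` of length two detects membership in a principal ideal:
if powers of `r` and of `s` multiply `g` into `(f)`, then `g ∈ (f)`. -/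
theorem dvd_of_dvd_pow_mul {R : Type*} [CommRing R] [IsDomain R] {r s f g : R} (hr : r ≠ 0)
    (hs : ∀ x, r ∣ s * x → r ∣ x) {m n : ℕ} (h1 : f ∣ r ^ m * g) (h2 : f ∣ s ^ n * g) :
    f ∣ g := by
  rcases eq_or_ne f 0 with rfl | hf
  · rw [zero_dvd_iff, mul_eq_zero] at h1
    rw [h1.resolve_left (pow_ne_zero _ hr)]
  have hs' : ∀ (j : ℕ) (x : R), r ∣ s ^ j * x → r ∣ x := by
    intro j
    induction j with
    | zero => intro x hx; simpa using hx
    | succ j ih =>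
      intro x hx
      rw [pow_succ, mul_assoc] at hx
      exact hs _ (ih _ hx)
  have hpow : ∀ (i : ℕ) (x : R), r ^ i ∣ s ^ n * x → r ^ i ∣ x := by
    intro i
    induction i with
    | zero => intro x _; simp
    | succ i ih =>
      intro x hx
      obtain ⟨y, rfl⟩ := hs' n x ((dvd_pow_self r i.succ_ne_zero).trans hx)
      rw [pow_succ', mul_left_comm] at hx
      rw [pow_succ']
      exact mul_dvd_mul_left r (ih y ((mul_dvd_mul_iff_left hr).1 hx))
  obtain ⟨u, hu⟩ := h1
  obtain ⟨v, hv⟩ := h2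
  have huv : s ^ n * u = r ^ m * v := by
    apply mul_left_cancel₀ hf
    calc f * (s ^ n * u) = s ^ n * (f * u) := by ring
      _ = r ^ m * (s ^ n * g) := by rw [← hu]; ring
      _ = f * (r ^ m * v) := by rw [hv]; ring
  obtain ⟨w, rfl⟩ := hpow m u ⟨v, huv⟩
  refine ⟨w, mul_left_cancel₀ (pow_ne_zero m hr) ?_⟩
  rw [hu]
  ring

/-- Depth at least two yields two elements of `m` that form a regular sequence. -/
theorem exists_regular_pair_of_two_le_depth {R : Type*} [CommRing R] [Nontrivial R] {m : Ideal R}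
    (h : 2 ≤ depth m) :
    ∃ r ∈ m, ∃ s ∈ m, r ≠ 0 ∧ ∀ x, r ∣ s * x → r ∣ x := by
  have h1 : (1 : ℕ∞) < depth m := lt_of_lt_of_le (by norm_num) h
  rw [depth, lt_iSup_iff] at h1
  obtain ⟨rs, h1⟩ := h1
  rw [lt_iSup_iff] at h1
  obtain ⟨⟨hreg, hmem⟩, h1⟩ := h1
  match rs, hreg, hmem, h1 with
  | [], _, _, h1 => simp at h1
  | [_], _, _, h1 => simp at h1
  | r :: s :: _, hreg, hmem, _ =>
    refine ⟨r, hmem r (by simp), s, hmem s (by simp), ?_, ?_⟩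
    · have hw := hreg.toIsWeaklyRegular
      rw [RingTheory.Sequence.isWeaklyRegular_cons_iff] at hw
      rintro rfl
      have := hw.1 (show (0 : R) • (1 : R) = (0 : R) • (0 : R) by simp)
      exact one_ne_zero this
    · have hw := hreg.toIsWeaklyRegular
      rw [RingTheory.Sequence.isWeaklyRegular_cons_iff,
        RingTheory.Sequence.isWeaklyRegular_cons_iff] at hw
      have hs := hw.2.1
      rw [isSMulRegular_quotient_iff_mem_of_smul_mem] at hs
      intro x hx
      have := hs x
      simp only [Submodule.mem_smul_pointwise_iff_exists, smul_eq_mul] at this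
      obtain ⟨y, hy⟩ := hx
      obtain ⟨z, -, hz⟩ := this ⟨y, trivial, hy.symm⟩
      exact ⟨z, hz.symm⟩

/-! ### The initial degree piece -/

/-- If `tr(I)` contains a set of forms of degree one that generates `⨁_{i > 0} R_i` up to radical,
and `I` is not principal, then the initial degree piece of `I` has dimension at least two. -/
theorem two_le_finrank_idealPiece {k R : Type*} [Field k] [CommRing R] [IsDomain R] [Algebra k R]
    (𝒜 : ℕ → Submodule k R) [GradedAlgebra 𝒜] (h0 : 𝒜 0 = (1 : Submodule k R))
    (hdepth : 2 ≤ gradedDepth 𝒜) {I : Ideal R} (hI : I.IsHomogeneous 𝒜)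
    (hnp : ¬ Submodule.IsPrincipal I) {E : Set R} (hE : ∀ e ∈ E, e ∈ 𝒜 1)
    (htr : ∀ e ∈ E, e ∈ traceIdeal 𝒜 I)
    (hrad : (HomogeneousIdeal.irrelevant 𝒜).toIdeal ≤ (Ideal.span E).radical) {b : ℕ}
    [Module.Finite k (𝒜 b)] (hb : IsLeast {i | idealPiece 𝒜 I i ≠ ⊥} b) :
    2 ≤ Module.finrank k (idealPiece 𝒜 I b) := by
  have hfin : Module.Finite k (idealPiece 𝒜 I b) :=
    Module.Finite.of_injective (Submodule.inclusion (inf_le_right : idealPiece 𝒜 I b ≤ 𝒜 b))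
      (Submodule.inclusion_injective _)
  by_contra hlt
  obtain ⟨f, hfmem, hf0⟩ := Submodule.exists_mem_ne_zero_of_ne_bot hb.1
  have hspan : ∀ g ∈ idealPiece 𝒜 I b, ∃ c : k, c • f = g := by
    intro g hg
    have hv : (⟨f, hfmem⟩ : idealPiece 𝒜 I b) ≠ 0 := fun h => hf0 (congrArg Subtype.val h)
    have hrank := Module.finrank_pos_iff_exists_ne_zero (R := k).2 ⟨_, hv⟩
    obtain ⟨c, hc⟩ := exists_smul_eq_of_finrank_eq_one (K := k) (by omega) hv ⟨g, hg⟩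
    exact ⟨c, congrArg Subtype.val hc⟩
  obtain ⟨hfI, hfb⟩ := hfmem
  have hne : ¬ I ≤ Ideal.span {f} := fun h =>
    hnp ⟨f, le_antisymm h ((Ideal.span_singleton_le_iff_mem I).2 hfI)⟩
  apply hne
  intro g hg
  have hcolon : Ideal.span E ≤ (Ideal.span {f}).colon {g} := by
    rw [Ideal.span_le]
    intro e he
    rw [SetLike.mem_coe, Submodule.mem_colon_singleton, smul_eq_mul]
    have := proj_one_mul_mem_span_of_mem_traceIdeal 𝒜 h0 hI hfb hfI hf0
      (fun i hi => by_contra fun h => (hb.2 h).not_gt hi) hspan hne (htr e he) hg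
    rwa [DirectSum.decompose_of_mem_same 𝒜 (hE e he)] at this
  obtain ⟨r, hr, s, hs, hr0, hrs⟩ := exists_regular_pair_of_two_le_depth hdepth
  obtain ⟨m, hm⟩ := hrad hr
  obtain ⟨n, hn⟩ := hrad hs
  replace hm := hcolon hm
  replace hn := hcolon hn
  rw [Submodule.mem_colon_singleton, smul_eq_mul, Ideal.mem_span_singleton] at hm hn
  exact Ideal.mem_span_singleton.2 (dvd_of_dvd_pow_mul hr0 hrs hm hn)

/-! ### Integrality over the degree-one piece -/

/-- If `k[M]` is integral over the subalgebra generated by its degree-one piece, then every element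
of `M` has a positive multiple that is a sum of elements of degree one: compare supports in an
equation of integral dependence. -/
theorem exists_nsmul_mem_closure_degree_one {k M : Type*} [Field k] [AddCommMonoid M] [IsCancelAdd M]
    (deg : M →+ ℕ)
    (hfin : Module.Finite (Algebra.adjoin k (AddMonoidAlgebra.gradeBy k deg 1 :
      Set (AddMonoidAlgebra k M))) (AddMonoidAlgebra k M)) (c : M) :
    ∃ m : ℕ, 0 < m ∧ m • c ∈ AddSubmonoid.closure {a : M | deg a = 1} := by
  classical
  set A := Algebra.adjoin k (AddMonoidAlgebra.gradeBy k deg 1 : Set (AddMonoidAlgebra k M))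
    with hA
  set T := AddSubmonoid.closure {a : M | deg a = 1} with hT
  have hsupp : ∀ x ∈ A, ∀ a ∈ x.coeff.support, a ∈ T := by
    intro x hx
    induction hx using Algebra.adjoin_induction with
    | mem x hx => exact fun a ha => AddSubmonoid.subset_closure (hx a ha)
    | algebraMap r =>
      intro a ha
      rw [AddMonoidAlgebra.coe_algebraMap] at ha
      have : a = 0 := Finset.mem_singleton.1 (Finsupp.support_single_subset ha)
      rw [this]
      exact T.zero_mem
    | add x y _ _ hx hy =>
      intro a ha
      exact (Finset.mem_union.1 (Finsupp.support_add ha)).elim (hx a) (hy a)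
    | mul x y _ _ hx hy =>
      intro a ha
      obtain ⟨u, hu, v, hv, rfl⟩ := Finset.mem_add.1
        (AddMonoidAlgebra.support_coeff_mul_subset x y ha)
      exact T.add_mem (hx u hu) (hy v hv)
  obtain ⟨p, hp, hpx⟩ := Algebra.IsIntegral.isIntegral (R := A)
    (AddMonoidAlgebra.single c (1 : k))
  rw [hp.as_sum, Polynomial.eval₂_add, Polynomial.eval₂_pow, Polynomial.eval₂_X,
    Polynomial.eval₂_finsetSum] at hpx
  set n := p.natDegree
  have hcoeff := congrArg (fun x : AddMonoidAlgebra k M => x.coeff (n • c)) hpx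
  simp only [Polynomial.eval₂_mul, Polynomial.eval₂_C, Polynomial.eval₂_pow, Polynomial.eval₂_X,
    AddMonoidAlgebra.single_pow, one_pow, AddMonoidAlgebra.coeff_add,
    AddMonoidAlgebra.coeff_zero, AddMonoidAlgebra.coeff_sum, Finsupp.add_apply,
    Finsupp.finsetSum_apply, AddMonoidAlgebra.coeff_single, Finsupp.single_eq_same,
    Finsupp.zero_apply] at hcoeff
  have hne : ∑ i ∈ Finset.range n, (algebraMap A (AddMonoidAlgebra k M) (p.coeff i) *
      AddMonoidAlgebra.single (i • c) (1 : k)).coeff (n • c) ≠ 0 := by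
    intro h
    rw [h, add_zero] at hcoeff
    exact one_ne_zero hcoeff
  obtain ⟨i, hi, hine⟩ := Finset.exists_ne_zero_of_sum_ne_zero hne
  have hmem := AddMonoidAlgebra.support_coeff_mul_single_subset _ _ _ (Finsupp.mem_support_iff.2 hine)
  obtain ⟨t, ht, hti⟩ := Finset.mem_image.1 hmem
  have hin : i < n := Finset.mem_range.1 hi
  refine ⟨n - i, by omega, ?_⟩
  have : (n - i) • c = t := by
    apply add_right_cancel (b := i • c)
    rw [hti, ← add_nsmul]
    congr 1
    omega
  rw [this]
  exact hsupp _ (p.coeff i).2 t ht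

/-! ### Faces of an affine semigroup -/

section Faces

variable {d : ℕ} {S : AddSubmonoid (Fin d → ℤ)}

/-- A face is generated by the generators of `S` that it contains. -/
theorem IsFace.induction {F : Set S} (hF : IsFace S F) {G : Set S}
    (hG : AddSubmonoid.closure G = ⊤) {p : S → Prop} (zero : p 0)
    (add : ∀ a ∈ F, ∀ b ∈ F, p a → p b → p (a + b)) (gen : ∀ g ∈ G, g ∈ F → p g) :
    ∀ c ∈ F, p c := by
  intro c
  have hc : c ∈ AddSubmonoid.closure G := hG ▸ AddSubmonoid.mem_top c
  induction hc using AddSubmonoid.closure_induction with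
  | mem g hg => exact gen g hg
  | zero => exact fun _ => zero
  | add a b _ _ ha hb =>
    intro hab
    obtain ⟨haF, hbF⟩ := (hF a b).1 hab
    exact add a haF b hbF (ha haF) (hb hbF)

theorem IsFace.zero_mem {F : Set S} (hF : IsFace S F) {c : S} (hc : c ∈ F) : (0 : S) ∈ F :=
  ((hF c 0).1 (by rwa [add_zero])).2

theorem IsFace.nsmul_mem {F : Set S} (hF : IsFace S F) {c : S} (hc : c ∈ F) (n : ℕ) :
    n • c ∈ F := by
  induction n with
  | zero => rw [zero_nsmul]; exact hF.zero_mem hc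
  | succ n ih => rw [succ_nsmul]; exact (hF _ _).2 ⟨ih, hc⟩

/-- The elements that divide some multiple of `a` form a face. -/
theorem isFace_setOf_exists_nsmul_eq_add (a : S) :
    IsFace S {c | ∃ (n : ℕ) (s : S), n • a = c + s} := by
  intro b c
  constructor
  · rintro ⟨n, s, h⟩
    exact ⟨⟨n, c + s, by rw [h, add_assoc]⟩, ⟨n, b + s, by rw [h]; abel⟩⟩
  · rintro ⟨⟨n, s, h⟩, ⟨m, t, h'⟩⟩
    exact ⟨n + m, s + t, by rw [add_nsmul, h, h']; abel⟩

/-- Below every nonzero `a` there is a nonzero face on which each coordinate is proportional to the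
degree. Among the nonzero faces below `a`, take one with the fewest generators; on it, the locus
where the ratio of a coordinate to the degree is maximal is again a nonzero face. -/
theorem exists_face_coord_mul_degree_eq (hS : S.FG) (deg : S →+ ℕ)
    (hpos : ∀ a : S, deg a = 0 → a = 0) {a : S} (ha : a ≠ 0) :
    ∃ F : Set S, IsFace S F ∧ (∀ c ∈ F, ∃ (n : ℕ) (s : S), n • a = c + s) ∧
      (∃ c ∈ F, c ≠ 0) ∧
      ∀ b ∈ F, ∀ c ∈ F, ∀ i, (b : Fin d → ℤ) i * deg c = (c : Fin d → ℤ) i * deg b := by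
  classical
  obtain ⟨G, hG⟩ := (AddMonoid.fg_iff_addSubmonoid_fg S).2 hS |>.fg_top
  obtain ⟨F, ⟨hF, hFa, hF0⟩, hmin⟩ := WellFounded.has_min
    (measure fun F : Set S => (F ∩ (G : Set S)).ncard).wf
    {F | IsFace S F ∧ (∀ c ∈ F, ∃ (n : ℕ) (s : S), n • a = c + s) ∧ ∃ c ∈ F, c ≠ 0}
    ⟨_, isFace_setOf_exists_nsmul_eq_add a, fun c hc => hc, a, ⟨1, 0, by simp⟩, ha⟩
  refine ⟨F, hF, hFa, hF0, ?_⟩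
  set H := G.filter fun g => g ∈ F ∧ deg g ≠ 0 with hH
  have hHne : H.Nonempty := by
    by_contra hemp
    obtain ⟨c, hc, hc0⟩ := hF0
    refine hc0 (hF.induction hG (p := fun c => c = 0) rfl ?_ ?_ c hc)
    · rintro x - y - rfl rfl
      rw [add_zero]
    · intro g hg hgF
      by_contra hg0
      exact hemp ⟨g, Finset.mem_filter.2 ⟨hg, hgF, fun h => hg0 (hpos g h)⟩⟩
  -- On `F`, the `i`-th coordinate is a fixed rational multiple of the degree.
  have key : ∀ i, ∃ g ∈ F, deg g ≠ 0 ∧ ∀ c ∈ F,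
      (c : Fin d → ℤ) i * deg g = (g : Fin d → ℤ) i * deg c := by
    intro i
    obtain ⟨g, hgH, hgmax⟩ := H.exists_max_image
      (fun g => ((g : Fin d → ℤ) i : ℚ) / (deg g : ℚ)) hHne
    obtain ⟨hgG, hgF, hg0⟩ := Finset.mem_filter.1 hgH
    refine ⟨g, hgF, hg0, ?_⟩
    have hle : ∀ c ∈ F, (c : Fin d → ℤ) i * deg g ≤ (g : Fin d → ℤ) i * deg c := by
      refine hF.induction hG (by simp) ?_ ?_
      · intro x _ y _ hx hy
        simp only [AddSubmonoid.coe_add, Pi.add_apply, map_add, Nat.cast_add]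
        linarith
      · intro c hc hcF
        by_cases hc0 : deg c = 0
        · rw [hpos c hc0]
          simp
        · have := hgmax c (Finset.mem_filter.2 ⟨hc, hcF, hc0⟩)
          rw [div_le_div_iff₀ (by positivity) (by positivity)] at this
          exact_mod_cast this
    have hF' : IsFace S {c | c ∈ F ∧ (c : Fin d → ℤ) i * deg g = (g : Fin d → ℤ) i * deg c} := by
      intro x y
      constructor
      · rintro ⟨hxy, h⟩
        obtain ⟨hx, hy⟩ := (hF x y).1 hxy
        have h1 := hle x hx
        have h2 := hle y hy
        simp only [AddSubmonoid.coe_add, Pi.add_apply, map_add, Nat.cast_add] at h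
        exact ⟨⟨hx, by linarith⟩, ⟨hy, by linarith⟩⟩
      · rintro ⟨⟨hx, h1⟩, ⟨hy, h2⟩⟩
        refine ⟨(hF x y).2 ⟨hx, hy⟩, ?_⟩
        simp only [AddSubmonoid.coe_add, Pi.add_apply, map_add, Nat.cast_add]
        linarith
    have hnlt := hmin _ ⟨hF', fun c hc => hFa c hc.1, g, ⟨hgF, rfl⟩, fun h => hg0 (by simp [h])⟩
    have heq := Set.eq_of_subset_of_ncard_le
      (Set.inter_subset_inter_left (G : Set S) fun c hc => hc.1) (not_lt.1 hnlt)
      (G.finite_toSet.inter_of_right F)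
    refine hF.induction hG (by simp) ?_ ?_
    · intro x _ y _ hx hy
      simp only [AddSubmonoid.coe_add, Pi.add_apply, map_add, Nat.cast_add]
      linarith
    · intro c hc hcF
      have : c ∈ F ∩ (G : Set S) := ⟨hcF, hc⟩
      rw [← heq] at this
      exact this.1.2
  intro b hb c hc i
  obtain ⟨g, -, hg0, hg⟩ := key i
  have h1 := hg b hb
  have h2 := hg c hc
  have hg0' : (deg g : ℤ) ≠ 0 := by exact_mod_cast hg0
  apply mul_right_cancel₀ hg0'
  linear_combination (deg c : ℤ) * h1 - (deg b : ℤ) * h2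

/-- Elements of degree one lie in every generating set. -/
theorem mem_minimalGenerators_of_degree_one (deg : S →+ ℕ) (hpos : ∀ a : S, deg a = 0 → a = 0)
    {e : S} (he : deg e = 1) : e ∈ minimalGenerators S := by
  intro G hG
  have hmem : e ∈ AddSubmonoid.closure G := hG ▸ AddSubmonoid.mem_top e
  induction hmem using AddSubmonoid.closure_induction with
  | mem x hx => exact hx
  | zero => simp at he
  | add x y _ _ hx hy =>
    rw [map_add] at he
    rcases Nat.eq_zero_or_pos (deg x) with h | h
    · rw [hpos x h, zero_add]
      exact hy (by omega)
    · rw [hpos y (by omega), add_zero]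
      exact hx (by omega)

/-- A nonzero face contains an element of degree one, provided that every element of `S` has a
positive multiple that is a sum of elements of degree one. -/
theorem IsFace.exists_mem_degree_eq_one {F : Set S} (hF : IsFace S F) (deg : S →+ ℕ)
    (hpos : ∀ a : S, deg a = 0 → a = 0)
    (hone : ∀ c : S, ∃ m : ℕ, 0 < m ∧ m • c ∈ AddSubmonoid.closure {a : S | deg a = 1})
    {c : S} (hc : c ∈ F) (hc0 : c ≠ 0) : ∃ e ∈ F, deg e = 1 := by
  obtain ⟨m, hm, hmem⟩ := hone c
  have hsum : ∀ t ∈ AddSubmonoid.closure {a : S | deg a = 1}, t ∈ F → t ≠ 0 →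
      ∃ e ∈ F, deg e = 1 := by
    intro t ht
    induction ht using AddSubmonoid.closure_induction with
    | mem x hx => exact fun hxF _ => ⟨x, hxF, hx⟩
    | zero => exact fun _ h => absurd rfl h
    | add x y _ _ hx hy =>
      intro hxy hxy0
      obtain ⟨hxF, hyF⟩ := (hF x y).1 hxy
      by_cases hx0 : x = 0
      · exact hy hyF (by rwa [hx0, zero_add] at hxy0)
      · exact hx hxF hx0
  refine hsum _ hmem (hF.nsmul_mem hc m) fun h => ?_
  have := congrArg deg h
  rw [map_nsmul, map_zero, smul_eq_mul, mul_eq_zero] at this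
  exact this.elim hm.ne' fun h => hc0 (hpos c h)

/-- A face on which the coordinates are proportional to the degree is the ray `ℕe` spanned by any
of its elements `e` of degree one. -/
theorem IsFace.eq_multiples {F : Set S} (hF : IsFace S F) (deg : S →+ ℕ)
    (hprop : ∀ b ∈ F, ∀ c ∈ F, ∀ i,
      (b : Fin d → ℤ) i * deg c = (c : Fin d → ℤ) i * deg b)
    {e : S} (he : e ∈ F) (he1 : deg e = 1) : F = (AddSubmonoid.multiples e : Set S) := by
  apply Set.Subset.antisymm
  · intro x hx
    refine (AddSubmonoid.mem_multiples_iff _ _).2 ⟨deg x, Subtype.ext (funext fun i => ?_)⟩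
    have := hprop x hx e he i
    rw [he1, Nat.cast_one, mul_one] at this
    rw [this, AddSubmonoidClass.coe_nsmul, Pi.smul_apply, nsmul_eq_mul, mul_comm]
  · intro x hx
    obtain ⟨n, rfl⟩ := (AddSubmonoid.mem_multiples_iff _ _).1 hx
    exact hF.nsmul_mem he n

theorem faceDim_multiples {e : S} (he : e ≠ 0) :
    faceDim S (AddSubmonoid.multiples e : Set S) = 1 := by
  have he0 : (e : Fin d → ℤ) ≠ 0 := fun h => he (Subtype.ext h)
  have hspan : Submodule.span ℤ ((fun a : S => (a : Fin d → ℤ)) ''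
      (AddSubmonoid.multiples e : Set S)) = Submodule.span ℤ {(e : Fin d → ℤ)} := by
    apply le_antisymm
    · rw [Submodule.span_le]
      rintro _ ⟨x, hx, rfl⟩
      obtain ⟨n, rfl⟩ := (AddSubmonoid.mem_multiples_iff _ _).1 hx
      exact nsmul_mem (Submodule.mem_span_singleton_self (e : Fin d → ℤ)) n
    · rw [Submodule.span_singleton_le_iff_mem]
      exact Submodule.subset_span ⟨e, AddSubmonoid.mem_multiples e, rfl⟩
  unfold faceDim
  rw [hspan]
  rw [← (LinearEquiv.toSpanNonzeroSingleton ℤ _ _ he0).finrank_eq, Module.finrank_self]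

/-- Every nonzero `a ∈ S` has a multiple lying in `e + S` for an extremal generator `e` of degree
one. Thus the extremal generators generate `k[S]_{> 0}` up to radical. -/
theorem exists_extremalGenerator_nsmul_eq_add (hS : S.FG) (deg : S →+ ℕ)
    (hpos : ∀ a : S, deg a = 0 → a = 0)
    (hone : ∀ c : S, ∃ m : ℕ, 0 < m ∧ m • c ∈ AddSubmonoid.closure {a : S | deg a = 1})
    {a : S} (ha : a ≠ 0) :
    ∃ e ∈ extremalGenerators S, deg e = 1 ∧ ∃ (n : ℕ) (s : S), n • a = e + s := by
  obtain ⟨F, hF, hFa, ⟨c, hc, hc0⟩, hprop⟩ := exists_face_coord_mul_degree_eq hS deg hpos ha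
  obtain ⟨e, he, he1⟩ := hF.exists_mem_degree_eq_one deg hpos hone hc hc0
  have he0 : e ≠ 0 := by
    rintro rfl
    rw [map_zero] at he1
    exact zero_ne_one he1
  exact ⟨e, ⟨mem_minimalGenerators_of_degree_one deg hpos he1,
    hF.eq_multiples deg hprop he he1 ▸ hF, faceDim_multiples he0⟩, he1, hFa e he⟩

/-- If only `0` has degree zero, then a finitely generated `S` has finitely many elements of each
degree. -/
theorem finite_setOf_degree_eq (hS : S.FG) (deg : S →+ ℕ) (hpos : ∀ a : S, deg a = 0 → a = 0)
    (b : ℕ) : {a : S | deg a = b}.Finite := by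
  classical
  obtain ⟨G, hG⟩ := (AddMonoid.fg_iff_addSubmonoid_fg S).2 hS |>.fg_top
  induction b using Nat.strong_induction_on with
  | _ b ih =>
    have hsub : {a : S | deg a = b} ⊆ {0} ∪ ⋃ g ∈ (G : Set S), ⋃ j ∈ Set.Iio b,
        (fun s => g + s) '' {a : S | deg a = j} := by
      intro a hab
      have ha : a ∈ AddSubmonoid.closure (G : Set S) := hG ▸ AddSubmonoid.mem_top a
      -- A nonzero element splits off a generator of positive degree.
      have hsplit : a = 0 ∨ ∃ g ∈ G, ∃ s : S, deg g ≠ 0 ∧ a = g + s := by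
        clear hab
        induction ha using AddSubmonoid.closure_induction with
        | mem g hg =>
          by_cases h : deg g = 0
          · exact Or.inl (hpos g h)
          · exact Or.inr ⟨g, hg, 0, h, (add_zero g).symm⟩
        | zero => exact Or.inl rfl
        | add x y _ _ hx hy =>
          rcases hx with rfl | ⟨g, hg, s, h, rfl⟩
          · rwa [zero_add]
          · exact Or.inr ⟨g, hg, s + y, h, add_assoc g s y⟩
      rcases hsplit with rfl | ⟨g, hg, s, h, rfl⟩
      · exact Or.inl rfl
      · right
        simp only [Set.mem_iUnion]
        have hdeg : deg g + deg s = b := by rw [← map_add]; exact hab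
        exact ⟨g, hg, deg s, by rw [Set.mem_Iio]; omega, s, rfl, rfl⟩
    refine Set.Finite.subset ?_ hsub
    refine (Set.finite_singleton _).union (G.finite_toSet.biUnion fun g _ => ?_)
    exact (Set.finite_Iio b).biUnion fun j hj => (ih j hj).image _

end Faces

/-! ### The semigroup ring -/

section SemigroupRing

variable {k : Type*} [Field k] {d : ℕ} {S : AddSubmonoid (Fin d → ℤ)}

theorem eq_zero_of_degree_eq_zero (deg : S →+ ℕ)
    (h0 : AddMonoidAlgebra.gradeBy k deg 0 = (1 : Submodule k (AddMonoidAlgebra k S)))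
    (a : S) (ha : deg a = 0) : a = 0 := by
  have h : AddMonoidAlgebra.single a (1 : k) ∈ AddMonoidAlgebra.gradeBy k deg 0 :=
    ha ▸ AddMonoidAlgebra.single_mem_gradeBy deg a 1
  rw [h0, Submodule.mem_one] at h
  obtain ⟨c, hc⟩ := h
  by_contra hne
  have := congrArg (fun x : AddMonoidAlgebra k S => x.coeff a) hc
  simp [Ne.symm hne] at this

theorem finite_gradeBy (hS : S.FG) (deg : S →+ ℕ) (hpos : ∀ a : S, deg a = 0 → a = 0) (b : ℕ) :
    Module.Finite k (AddMonoidAlgebra.gradeBy k deg b) := by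
  have hspan : AddMonoidAlgebra.gradeBy k deg b ≤
      Submodule.span k (AddMonoidAlgebra.of' k S '' {a | deg a = b}) := fun x hx =>
    Submodule.span_mono (Set.image_mono fun a ha => hx a ha)
      (AddMonoidAlgebra.mem_span_support_coeff x)
  have := Module.Finite.span_of_finite k
    ((finite_setOf_degree_eq hS deg hpos b).image (AddMonoidAlgebra.of' k S))
  exact Module.Finite.of_injective (Submodule.inclusion hspan)
    (Submodule.inclusion_injective hspan)

theorem isDomain_addMonoidAlgebra : IsDomain (AddMonoidAlgebra k S) := by
  have : UniqueSums S := UniqueSums.of_injective_addHom (S.subtype : S →ₙ+ (Fin d → ℤ))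
    Subtype.val_injective inferInstance
  exact NoZeroDivisors.to_isDomain _

/-- An ideal that contains `x^e` for the extremal generators `e` of degree one contains
`⨁_{i > 0} R_i` up to radical. -/
theorem irrelevant_le_radical (hS : S.FG) (deg : S →+ ℕ) (hpos : ∀ a : S, deg a = 0 → a = 0)
    (hone : ∀ c : S, ∃ m : ℕ, 0 < m ∧ m • c ∈ AddSubmonoid.closure {a : S | deg a = 1})
    {J : Ideal (AddMonoidAlgebra k S)}
    (hJ : ∀ e ∈ extremalGenerators S, deg e = 1 → AddMonoidAlgebra.single e (1 : k) ∈ J) :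
    (HomogeneousIdeal.irrelevant (AddMonoidAlgebra.gradeBy k deg)).toIdeal ≤ J.radical := by
  classical
  intro x hx
  have hmono : ∀ a : S, a ≠ 0 → AddMonoidAlgebra.single a (1 : k) ∈ J.radical := by
    intro a ha
    obtain ⟨e, he, he1, n, s, hns⟩ := exists_extremalGenerator_nsmul_eq_add hS deg hpos hone ha
    refine ⟨n, ?_⟩
    rw [AddMonoidAlgebra.single_pow, hns, one_pow]
    have := J.mul_mem_right (AddMonoidAlgebra.single s 1) (hJ e he he1)
    rwa [AddMonoidAlgebra.single_mul_single, mul_one] at this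
  have hsupp : ∀ a ∈ x.coeff.support, a ≠ 0 := by
    rintro _ ha rfl
    have hx0 : (DirectSum.decompose (AddMonoidAlgebra.gradeBy k deg) x 0 :
        AddMonoidAlgebra k S) = 0 := (HomogeneousIdeal.mem_irrelevant_iff _ _).1 hx
    have hcoeff := congrArg (fun y : AddMonoidAlgebra k S => y.coeff 0)
      (DirectSum.sum_support_decompose (AddMonoidAlgebra.gradeBy k deg) x)
    simp only [AddMonoidAlgebra.coeff_sum, Finsupp.finsetSum_apply] at hcoeff
    refine Finsupp.mem_support_iff.1 ha (hcoeff.symm.trans (Finset.sum_eq_zero fun i _ => ?_))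
    by_contra h
    have hi : deg 0 = i := SetLike.coe_mem (DirectSum.decompose (AddMonoidAlgebra.gradeBy k deg) x i)
      0 (Finsupp.mem_support_iff.2 h)
    rw [map_zero] at hi
    subst hi
    rw [hx0] at h
    exact h rfl
  have := AddMonoidAlgebra.mem_span_support_coeff x
  refine (Submodule.span_le (p := J.radical.restrictScalars k)).2 ?_ this
  rintro _ ⟨a, ha, rfl⟩
  exact hmono a (hsupp a ha)

end SemigroupRing

end SemiStandard

open SemiStandard in
theorem theorem3p5 {k : Type*} [Field k] {d : ℕ}
    (S : AddSubmonoid (Fin d → ℤ)) (hS : S.FG) (deg : S →+ ℕ)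
    (hR : SemiStandard.IsSemiStandardGraded (AddMonoidAlgebra.gradeBy k deg))
    (hdepth : 2 ≤ SemiStandard.gradedDepth (AddMonoidAlgebra.gradeBy k deg))
    (I : Ideal (AddMonoidAlgebra k S))
    (hI : I.IsHomogeneous (AddMonoidAlgebra.gradeBy k deg))
    (hnp : ¬ Submodule.IsPrincipal I)
    (htr : SemiStandard.extremalIdeal k S ≤
      SemiStandard.traceIdeal (AddMonoidAlgebra.gradeBy k deg) I)
    (b : ℕ)
    (hb : IsLeast {i | SemiStandard.idealPiece (AddMonoidAlgebra.gradeBy k deg) I i ≠ ⊥} b) :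
    2 ≤ Module.finrank k (SemiStandard.idealPiece (AddMonoidAlgebra.gradeBy k deg) I b) := by
  have := isDomain_addMonoidAlgebra (k := k) (S := S)
  have hpos := eq_zero_of_degree_eq_zero deg hR.degree_zero
  have := finite_gradeBy (k := k) hS deg hpos b
  have hone := exists_nsmul_mem_closure_degree_one deg hR.finite
  refine two_le_finrank_idealPiece (AddMonoidAlgebra.gradeBy k deg) hR.degree_zero hdepth hI hnp
    (E := (fun e : S => AddMonoidAlgebra.single e (1 : k)) ''
      {e | e ∈ extremalGenerators S ∧ deg e = 1}) ?_ ?_ ?_ hb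
  · rintro _ ⟨e, ⟨-, he1⟩, rfl⟩
    have := AddMonoidAlgebra.single_mem_gradeBy deg e (1 : k)
    rwa [he1] at this
  · rintro _ ⟨e, ⟨he, -⟩, rfl⟩
    exact htr (Ideal.subset_span (Set.mem_image_of_mem _ he))
  · exact irrelevant_le_radical hS deg hpos hone fun e he he1 =>
      Ideal.subset_span (Set.mem_image_of_mem _ ⟨he, he1⟩)
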